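/- Let $P$ be a Markov transition kernel on a general measurable space $(\mathsf X,\mathcal B)$ whose associated Markov chain is $\pi$-irreducible and positive Harris recurrent, where $\pi$ is the invariant probability measure. Assume the one-step minorization condition: there are a measurable set $C$ with $\pi(C)>0$, a number $\varepsilon\in(0,1)$ and a probability measure $\nu$ with $P(x,\cdot)\ge\varepsilon\,\nu(\cdot)$ for all $x\in C$. Assume also the geometric drift condition: there are a measurable $V:\mathsf X\to[1,\infty)$, $\lambda\in(0,1)$ and $b<\infty$ with $PV(x):=\int V(y)\,P(x,dy)\le\lambda V(x)+b\,\mathbf 1_C(x)$ for all $x\in\mathsf X$. Put $A=\sup_{x\in C}PV(x)$, assumed finite, $J=(A-\varepsilon)/\lambda$, and let $$\beta^*=\lambda^{-1}\ \text{ if } J<1,\qquad \beta^*=\exp\left\{\frac{\log\lambda\,\log(1-\varepsilon)}{\log J-\log(1-\varepsilon)}\right\}\ \text{ if } J\ge1.$$ With $\phi(\beta)=\log\beta/\log\lambda^{-1}$ and $\nu(V)=\int V\,d\nu$, put $$g(\beta,\varepsilon,J)=\beta\,[\nu(V)]^{\phi(\beta)}\,\frac{1-\beta(1-\varepsilon)}{1-(1-\varepsilon)\,(J/(1-\varepsilon))^{\phi(\beta)}}.$$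 Let $R(x,\cdot)=(1-\varepsilon)^{-1}(P(x,\cdot)-\varepsilon\nu(\cdot))$ for $x\in C$. The split chain $(X_n,\delta_n)_{n\ge0}$ is the Markov chain on $\mathsf X\times\{0,1\}$ which from $(x,\delta)$ draws its next first coordinate from $P(x,\cdot)$ if $x\notin C$, from $\nu$ if $x\in C$ and $\delta=1$, and from $R(x,\cdot)$ if $x\in C$ and $\delta=0$, and independently draws its next second coordinate from the Bernoulli$(\varepsilon)$ distribution. Let $\alpha=C\times\{1\}$, let $\tau_\alpha=\min\{n\ge1:(X_n,\delta_n)\in\alpha\}$, and let $\Pr_\alpha$ be the probability conditional on $(X_0,\delta_0)\in\alpha$ (so that $X_1\sim\nu$), for any initial distribution that charges $\alpha$. For $t\ge1$ let $Q_t(\cdot)=\Pr_\alpha(X_t\in\cdot\mid\tau_\alpha\ge t)$. Fix $\gamma>0$ and $\beta\in(1,\beta^*)$, let $M\ge1$ be any integer with $$M>\log\left[\frac{2g(\beta,\varepsilon,J)}{\gamma(\beta-1)}\right]\Big/\log\beta,$$ and for $1\le t\le M$ put $\tilde p_t=\Pr_\alpha(\tau_\alpha\ge t)\big/\sum_{s=1}^M\Pr_\alpha(\tau_\alpha\ge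 s)$ and $\tilde\pi=\sum_{t=1}^M\tilde p_t\,Q_t$. (If $\Pr_\alpha(\tau_\alpha\ge t)=0$, then $\tilde p_t=0$ and the term $\tilde p_tQ_t$ is $0$.) Then $\|\pi-\tilde\pi\|\le\gamma$, where $\|\cdot\|$ is the total variation norm of a signed measure, $\|\mu\|=|\mu|(\mathsf X)$. -/

import Mathlib

open MeasureTheory ProbabilityTheory
open scoped ENNReal

namespace SplitChain

noncomputable section

/-! ### Time-homogeneous Markov chains and positive Harris recurrence -/

/-- The law on path space `ℕ → S` of the time-homogeneous Markov chain with transition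
kernel `κ` and initial distribution `μ`. -/
def chainLaw {S : Type*} [MeasurableSpace S] (κ : Kernel S S) [IsMarkovKernel κ]
    (μ : Measure S) : Measure (ℕ → S) :=
  Kernel.trajMeasure (X := fun _ : ℕ => S) μ
    (fun n => κ.comap (fun h : (i : Finset.Iic n) → S => h ⟨n, Finset.mem_Iic.2 le_rfl⟩)
      (measurable_pi_apply _))

/-- The chain with transition kernel `P` is `π`-irreducible and positive Harris recurrent with
invariant probability measure `π`: the probability measure `π` is invariant, the chain is
`π`-irreducible, and, started anywhere in a measurable set `A` with `π A > 0`, the chain almost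
surely visits `A` infinitely often. (As `π` is invariant, it is a maximal irreducibility
measure, so the sets `A` with `π A > 0` are exactly those of the usual definition.) -/
structure IsPositiveHarris {X : Type*} [MeasurableSpace X] (P : Kernel X X) [IsMarkovKernel P]
    (π : Measure X) [IsProbabilityMeasure π] : Prop where
  invariant : Kernel.Invariant P π
  irreducible : Kernel.IsIrreducible π P
  harris : ∀ A : Set X, MeasurableSet A → 0 < π A → ∀ x ∈ A,
    ∀ᵐ ω ∂(chainLaw P (Measure.dirac x)), ∃ᶠ n in Filter.atTop, ω n ∈ A

/-! ### The minorization condition and the split chain -/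

/-- One-step minorization condition: `P(x, ·) ≥ ε ν(·)` for all `x ∈ C`, with `0 < ε < 1`. -/
structure Minorization {X : Type*} [MeasurableSpace X] (P : Kernel X X) (C : Set X) (ε : ℝ)
    (ν : Measure X) : Prop where
  measurableSet : MeasurableSet C
  pos : 0 < ε
  lt_one : ε < 1
  le : ∀ x ∈ C, ENNReal.ofReal ε • ν ≤ P x

section Split

variable {X : Type*} [MeasurableSpace X] {P : Kernel X X} [IsMarkovKernel P] {C : Set X}
  {ε : ℝ} {ν : Measure X} [IsProbabilityMeasure ν]

open Classical in
/-- The residual measures `R(x, ·) = (1 - ε)⁻¹ (P(x, ·) - ε ν(·))` for `x ∈ C`, and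
`R(x, ·) = 0` for `x ∉ C`. -/
def residual (h : Minorization P C ε ν) : Kernel X X where
  toFun x := if x ∈ C then (ENNReal.ofReal (1 - ε))⁻¹ • (P x - ENNReal.ofReal ε • ν) else 0
  measurable' := by
    refine Measure.measurable_of_measurable_coe _ fun s hs => ?_
    have key : (fun x => (if x ∈ C then
        (ENNReal.ofReal (1 - ε))⁻¹ • (P x - ENNReal.ofReal ε • ν) else 0 : Measure X) s)
        = fun x => if x ∈ C then
          (ENNReal.ofReal (1 - ε))⁻¹ * (P x s - ENNReal.ofReal ε * ν s) else 0 := by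
      funext x
      by_cases hx : x ∈ C
      · have : IsFiniteMeasure (ENNReal.ofReal ε • ν) := ν.smul_finite ENNReal.ofReal_ne_top
        simp only [hx, if_true, Measure.smul_apply, smul_eq_mul,
          Measure.sub_apply hs (h.le x hx)]
      · simp [hx]
    rw [key]
    exact Measurable.ite h.measurableSet
      (((P.measurable_coe hs).sub measurable_const).const_mul _) measurable_const

open Classical in
/-- The law of the next state given the current state `(x, δ)` of the split chain: `P(x, ·)` if
`x ∉ C`, and, if `x ∈ C`, `ν` for `δ = 1` and `R(x, ·)` for `δ = 0`. -/
def splitStep (h : Minorization P C ε ν) : Kernel (X × Bool) X :=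
  Kernel.piecewise (s := Prod.fst ⁻¹' C) (measurable_fst h.measurableSet)
    (Kernel.piecewise (s := Prod.snd ⁻¹' {true})
      (measurable_snd (measurableSet_singleton true))
      (Kernel.const _ ν) ((residual h).comap Prod.fst measurable_fst))
    (P.comap Prod.fst measurable_fst)

/-- The `Ber(ε)` distribution on `{0, 1}` (`true` is `1`). -/
def ber (ε : ℝ) : Measure Bool :=
  ENNReal.ofReal ε • Measure.dirac true + ENNReal.ofReal (1 - ε) • Measure.dirac false

/-- The transition kernel `P'` of the split chain on `X × {0, 1}`: the next state is drawn from
`splitStep` and, independently, the next `δ` from `Ber(ε)`. -/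
def splitKernel (h : Minorization P C ε ν) : Kernel (X × Bool) (X × Bool) :=
  (splitStep h) ×ₖ (Kernel.const _ (ber ε))

open Classical in
lemma isProbabilityMeasure_residual (h : Minorization P C ε ν) {x : X} (hx : x ∈ C) :
    IsProbabilityMeasure (residual h x) := by
  have : IsFiniteMeasure (ENNReal.ofReal ε • ν) := ν.smul_finite ENNReal.ofReal_ne_top
  refine ⟨?_⟩
  have h0 : (0 : ℝ) < 1 - ε := by linarith [h.lt_one]
  have e1 : residual h x = (ENNReal.ofReal (1 - ε))⁻¹ • (P x - ENNReal.ofReal ε • ν) := by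
    change (if x ∈ C then _ else _) = _
    rw [if_pos hx]
  rw [e1, Measure.smul_apply, Measure.sub_apply MeasurableSet.univ (h.le x hx)]
  simp only [Measure.smul_apply, measure_univ, smul_eq_mul, mul_one]
  rw [← ENNReal.ofReal_one, ← ENNReal.ofReal_sub _ h.pos.le]
  rw [ENNReal.ofReal_one]
  exact ENNReal.inv_mul_cancel (ENNReal.ofReal_pos.2 h0).ne' ENNReal.ofReal_ne_top

instance (h : Minorization P C ε ν) : IsMarkovKernel (splitStep h) := by
  classical
  refine ⟨fun z => ?_⟩
  unfold splitStep
  rw [Kernel.piecewise_apply]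
  split_ifs with hC
  · rw [Kernel.piecewise_apply]
    split_ifs
    · rw [Kernel.const_apply]; infer_instance
    · rw [Kernel.comap_apply]; exact isProbabilityMeasure_residual h hC
  · rw [Kernel.comap_apply]; infer_instance

lemma isProbabilityMeasure_ber (h : Minorization P C ε ν) : IsProbabilityMeasure (ber ε) := by
  refine ⟨?_⟩
  have h0 : (0 : ℝ) ≤ 1 - ε := by linarith [h.lt_one]
  simp only [ber, Measure.add_apply, Measure.smul_apply, measure_univ, smul_eq_mul, mul_one]
  rw [← ENNReal.ofReal_add h.pos.le h0]
  simp

instance (h : Minorization P C ε ν) : IsMarkovKernel (splitKernel h) := by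
  have := isProbabilityMeasure_ber h
  unfold splitKernel
  infer_instance

/-- The atom `α = C × {1}`. -/
def atom (C : Set X) : Set (X × Bool) := C ×ˢ {true}

/-- The first return time `τ_α = min {n ≥ 1 : (X_n, δ_n) ∈ α}` of a path (`⊤` if there is no
return). -/
def returnTime (C : Set X) (ω : ℕ → X × Bool) : ℕ∞ :=
  ⨅ (n : ℕ) (_ : 1 ≤ n ∧ ω n ∈ atom C), (n : ℕ∞)

/-- `Pr_α`: the law of the split chain with initial distribution `μ`, conditional on
`(X_0, δ_0) ∈ α`. -/
def prAtom (h : Minorization P C ε ν) (μ : Measure (X × Bool)) : Measure (ℕ → X × Bool) :=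
  ProbabilityTheory.cond (chainLaw (splitKernel h) μ) {ω | ω 0 ∈ atom C}

/-- The tail probability `Pr_α(τ_α ≥ t)`. -/
def tailProb (h : Minorization P C ε ν) (μ : Measure (X × Bool)) (t : ℕ) : ℝ :=
  (prAtom h μ).real {ω | (t : ℕ∞) ≤ returnTime C ω}

/-- `Q_t(A) = Pr_α(X_t ∈ A | τ_α ≥ t)`. -/
def Q (h : Minorization P C ε ν) (μ : Measure (X × Bool)) (t : ℕ) : Measure X :=
  (ProbabilityTheory.cond (prAtom h μ) {ω | (t : ℕ∞) ≤ returnTime C ω}).map (fun ω => (ω t).1)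

/-- The truncated weights `p̃_t = Pr_α(τ_α ≥ t) / ∑_{s=1}^M Pr_α(τ_α ≥ s)`, `1 ≤ t ≤ M`. -/
def pTilde (h : Minorization P C ε ν) (μ : Measure (X × Bool)) (M t : ℕ) : ℝ :=
  tailProb h μ t / ∑ s ∈ Finset.Icc 1 M, tailProb h μ s

/-- The approximation `π̃ = ∑_{t=1}^M p̃_t Q_t`. -/
def piTilde (h : Minorization P C ε ν) (μ : Measure (X × Bool)) (M : ℕ) : Measure X :=
  ∑ t ∈ Finset.Icc 1 M, ENNReal.ofReal (pTilde h μ M t) • Q h μ t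

instance (h : Minorization P C ε ν) (μ : Measure (X × Bool)) (M : ℕ) :
    IsFiniteMeasure (piTilde h μ M) := by
  unfold piTilde
  refine ⟨?_⟩
  rw [Measure.finsetSum_apply]
  refine ENNReal.sum_lt_top.2 fun t _ => ?_
  rw [Measure.smul_apply, smul_eq_mul]
  refine ENNReal.mul_lt_top ENNReal.ofReal_lt_top ?_
  unfold Q
  exact measure_lt_top _ _

end Split

/-! ### The drift condition and the explicit constants -/

/-- `PV(x) = ∫ V(y) P(x, dy)`, for a nonnegative function `V`. -/
def PV {X : Type*} [MeasurableSpace X] (P : Kernel X X) (V : X → ℝ) (x : X) : ℝ≥0∞ :=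
  ∫⁻ y, ENNReal.ofReal (V y) ∂(P x)

/-- Geometric drift condition: `V : X → [1, ∞)` is measurable, `0 < lam < 1`, and
`PV ≤ lam V + b 1_C` everywhere. -/
structure GeometricDrift {X : Type*} [MeasurableSpace X] (P : Kernel X X) (C : Set X)
    (V : X → ℝ) (lam b : ℝ) : Prop where
  measurable : Measurable V
  one_le : ∀ x, 1 ≤ V x
  lam_pos : 0 < lam
  lam_lt_one : lam < 1
  drift : ∀ x, PV P V x ≤ ENNReal.ofReal (lam * V x + C.indicator (fun _ => b) x)

/-- `sup_{x ∈ C} PV(x)`. -/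
def supPV {X : Type*} [MeasurableSpace X] (P : Kernel X X) (C : Set X) (V : X → ℝ) : ℝ≥0∞ :=
  ⨆ x ∈ C, PV P V x

/-- `J = (A - ε) / lam`, where `A = sup_{x ∈ C} PV(x)`. -/
def J {X : Type*} [MeasurableSpace X] (P : Kernel X X) (C : Set X) (V : X → ℝ) (ε lam : ℝ) : ℝ :=
  ((supPV P C V).toReal - ε) / lam

/-- `β* = lam⁻¹` if `J < 1`, and
`β* = exp (log lam * log (1 - ε) / (log J - log (1 - ε)))` if `J ≥ 1`. -/
def betaStar (ε lam J : ℝ) : ℝ :=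
  if J < 1 then lam⁻¹
  else Real.exp (Real.log lam * Real.log (1 - ε) / (Real.log J - Real.log (1 - ε)))

/-- `φ(β) = log β / log lam⁻¹`. -/
def phi (lam β : ℝ) : ℝ := Real.log β / Real.log lam⁻¹

/-- `g(β, ε, J) = β [ν(V)]^φ(β) (1 - β (1 - ε)) / (1 - (1 - ε) (J / (1 - ε))^φ(β))`, where
`nuV` stands for `ν(V)`. -/
def g (nuV lam β ε J : ℝ) : ℝ :=
  β * nuV ^ phi lam β *
    ((1 - β * (1 - ε)) / (1 - (1 - ε) * (J / (1 - ε)) ^ phi lam β))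

end

end SplitChain

/-!
With the second coordinate averaged out, the split chain killed in the atom `α = C × {1}` moves by
the defective kernel `T` (`taboo`) on `X` equal to `P` off `C` and to `(1 - ε) R` on `C`. Hence
`Pr_α(X_{n+1} ∈ ·, τ_α ≥ n + 1) = ν Tⁿ` (`prAtom_returnTime_inter`), and `π̃` is the normalization
of `∑_{i < M} ν Tⁱ` (`piTilde_real_apply`). On the other hand, invariance of `π` reads
`π = ε π(C) ν + π T`, and iterating it gives `π = ε π(C) ∑_{i < M} ν Tⁱ + π Tᴹ`
(`invariant_eq_sum_add`). So `π` and `π̃` are proportional up to the remainder `π Tᴹ`, and they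
differ by at most `π Tᴹ(X)` on every set.

To bound the remainder, let `W = V ^ φ(β)`, where `φ(β) ∈ (0, 1)`. By Jensen's inequality the
drift condition gives `T W ≤ β⁻¹ W` off `C`. On `C`, as `R V ≤ (A - ε) / (1 - ε)`, Jensen's
inequality gives `T W ≤ β⁻¹ (1 - ε) (J / (1 - ε)) ^ φ(β)`, which is at most `β⁻¹` because
`β < β*` (`lintegral_taboo_le`). As `W ≥ 1`, it follows that `Tⁿ 1 ≤ β⁻ⁿ W`. Thus `π Tⁿ(X) → 0`,
so that `π Tᴹ(X) = ε π(C) ∑_{i ≥ M} ν Tⁱ(X)`, and this is at most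
`∑_{i ≥ M} ν(V) ^ φ(β) β⁻ⁱ = β ν(V) ^ φ(β) β⁻ᴹ / (β - 1)`. Finally `β ν(V) ^ φ(β) ≤ g`
(`mul_rpow_le_g`), and the condition on `M` says `g β⁻ᴹ / (β - 1) < γ / 2`.

What carries the estimate is the tail bound `Pr_α(τ_α ≥ t) ≤ ν(V) ^ φ(β) β^{-(t-1)} ≤ g β⁻ᵗ`. The
moment bound `E_α[β ^ τ_α] ≤ g` is stronger and can fail: for `V = 1`, `C = X` and
`1 - ε < λ` the time `τ_α` is geometric, `E_α[β ^ τ_α] = β ε / (1 - β (1 - ε))`, but `g = β`.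
-/

set_option linter.unusedSectionVars false

namespace SplitChain

/-! ### The taboo kernel -/

section Taboo

variable {X : Type*} [MeasurableSpace X] {P : Kernel X X} [IsMarkovKernel P] {C : Set X}
  {ε : ℝ} {ν : Measure X} [IsProbabilityMeasure ν]

open Classical in
/-- The transition kernel of the first coordinate of the split chain killed at its next step once
it is in the atom `C × {1}`, with the second coordinate averaged out: `P(x, ·)` off `C`, and the
defective measure `(1 - ε) R(x, ·) = P(x, ·) - ε ν` on `C`. -/
noncomputable def taboo (h : Minorization P C ε ν) : Kernel X X where
  toFun x := if x ∈ C then ENNReal.ofReal (1 - ε) • residual h x else P x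
  measurable' := by
    refine Measurable.ite h.measurableSet ?_ P.measurable
    refine Measure.measurable_of_measurable_coe _ fun s hs => ?_
    simpa using ((residual h).measurable_coe hs).const_mul _

lemma taboo_apply_of_mem (h : Minorization P C ε ν) {x : X} (hx : x ∈ C) :
    taboo h x = ENNReal.ofReal (1 - ε) • residual h x :=
  if_pos hx

lemma taboo_apply_of_notMem (h : Minorization P C ε ν) {x : X} (hx : x ∉ C) :
    taboo h x = P x :=
  if_neg hx

/-- On `C` the transition law is the mixture `ε ν + (1 - ε) R(x, ·)`. -/
lemma smul_add_taboo (h : Minorization P C ε ν) {x : X} (hx : x ∈ C) :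
    ENNReal.ofReal ε • ν + taboo h x = P x := by
  have : IsFiniteMeasure (ENNReal.ofReal ε • ν) := ν.smul_finite ENNReal.ofReal_ne_top
  have h0 : (0 : ℝ) < 1 - ε := by linarith [h.lt_one]
  have e1 : residual h x = (ENNReal.ofReal (1 - ε))⁻¹ • (P x - ENNReal.ofReal ε • ν) :=
    if_pos hx
  rw [taboo_apply_of_mem h hx, e1, smul_smul,
    ENNReal.mul_inv_cancel (ENNReal.ofReal_pos.2 h0).ne' ENNReal.ofReal_ne_top, one_smul, add_comm,
    Measure.sub_add_cancel_of_le (h.le x hx)]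

lemma taboo_le (h : Minorization P C ε ν) (x : X) : taboo h x ≤ P x := by
  by_cases hx : x ∈ C
  · rw [← smul_add_taboo h hx]
    exact Measure.le_add_left le_rfl
  · rw [taboo_apply_of_notMem h hx]

instance (h : Minorization P C ε ν) : IsFiniteKernel (taboo h) :=
  ⟨⟨1, ENNReal.one_lt_top, fun x => (taboo_le h x _).trans prob_le_one⟩⟩

lemma taboo_pow_apply_univ_le_one (h : Minorization P C ε ν) (n : ℕ) (x : X) :
    (taboo h ^ n) x Set.univ ≤ 1 := by
  induction n with
  | zero => change Kernel.id x _ ≤ 1; rw [Kernel.id_apply]; exact prob_le_one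
  | succ n ih =>
    rw [Kernel.pow_succ_apply_eq_lintegral _ _ _ MeasurableSet.univ]
    calc ∫⁻ b, taboo h b Set.univ ∂((taboo h ^ n) x)
        ≤ ∫⁻ _, 1 ∂((taboo h ^ n) x) :=
          lintegral_mono fun b => (taboo_le h b _).trans prob_le_one
      _ ≤ 1 := by simpa using ih

lemma taboo_pow_comp_univ_le_one (h : Minorization P C ε ν) (n : ℕ) (μ : Measure X)
    [IsProbabilityMeasure μ] : ((taboo h ^ n) ∘ₘ μ) Set.univ ≤ 1 := by
  rw [Measure.bind_apply MeasurableSet.univ (Kernel.aemeasurable _)]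
  calc ∫⁻ x, (taboo h ^ n) x Set.univ ∂μ ≤ ∫⁻ _, 1 ∂μ :=
        lintegral_mono fun x => taboo_pow_apply_univ_le_one h n x
    _ = 1 := by simp

instance (h : Minorization P C ε ν) (n : ℕ) (μ : Measure X) [IsProbabilityMeasure μ] :
    IsFiniteMeasure ((taboo h ^ n) ∘ₘ μ) :=
  ⟨(taboo_pow_comp_univ_le_one h n μ).trans_lt ENNReal.one_lt_top⟩

lemma taboo_pow_succ_comp (h : Minorization P C ε ν) (n : ℕ) (μ : Measure X) :
    (taboo h ^ (n + 1)) ∘ₘ μ = taboo h ∘ₘ ((taboo h ^ n) ∘ₘ μ) := by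
  rw [pow_succ', Measure.comp_assoc]; rfl

lemma taboo_pow_succ_comp' (h : Minorization P C ε ν) (n : ℕ) (μ : Measure X) :
    (taboo h ^ (n + 1)) ∘ₘ μ = (taboo h ^ n) ∘ₘ (taboo h ∘ₘ μ) := by
  rw [pow_succ, Measure.comp_assoc]; rfl

/-! ### Expansion of the invariant measure over excursions from the atom -/

/-- Decomposition of an invariant measure according to whether the preceding state of the split
chain lies in the atom. -/
lemma invariant_eq_add_taboo (h : Minorization P C ε ν) {π : Measure X}
    (hπ : Kernel.Invariant P π) :
    π = (ENNReal.ofReal ε * π C) • ν + taboo h ∘ₘ π := by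
  classical
  ext s hs
  have key : ∀ x, P x s = C.indicator (fun _ => ENNReal.ofReal ε * ν s) x + taboo h x s := by
    intro x
    by_cases hx : x ∈ C
    · rw [← smul_add_taboo h hx]; simp [hx]
    · simp [taboo_apply_of_notMem h hx, hx]
  conv_lhs => rw [← hπ.def]
  rw [Measure.bind_apply hs (Kernel.aemeasurable _), Measure.add_apply,
    Measure.bind_apply hs (Kernel.aemeasurable _)]
  simp_rw [key]
  rw [lintegral_add_left (measurable_const.indicator h.measurableSet),
    lintegral_indicator h.measurableSet]
  simp only [lintegral_const, Measure.restrict_apply_univ, Measure.smul_apply, smul_eq_mul]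
  ring

/-- The expansion of an invariant measure along the last visit to the atom during the
preceding `n` steps; as `n → ∞` this becomes Kac's formula. -/
lemma invariant_eq_sum_add (h : Minorization P C ε ν) {π : Measure X}
    (hπ : Kernel.Invariant P π) (n : ℕ) :
    π = (ENNReal.ofReal ε * π C) • ∑ i ∈ Finset.range n, (taboo h ^ i) ∘ₘ ν
      + (taboo h ^ n) ∘ₘ π := by
  induction n with
  | zero => simp [show (1 : Kernel X X) = Kernel.id from rfl]
  | succ n ih =>
    have e : (taboo h ^ n) ∘ₘ π = (ENNReal.ofReal ε * π C) • ((taboo h ^ n) ∘ₘ ν)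
        + (taboo h ^ (n + 1)) ∘ₘ π := by
      rw [taboo_pow_succ_comp', ← Measure.comp_smul, ← Measure.comp_add,
        ← invariant_eq_add_taboo h hπ]
    conv_lhs => rw [ih, e]
    rw [Finset.sum_range_succ, smul_add, add_assoc]

lemma invariant_real_apply (h : Minorization P C ε ν) {π : Measure X} [IsProbabilityMeasure π]
    (hπ : Kernel.Invariant P π) (n : ℕ) (A : Set X) :
    π.real A = ε * π.real C * ∑ i ∈ Finset.range n, ((taboo h ^ i) ∘ₘ ν).real A
      + ((taboo h ^ n) ∘ₘ π).real A := by
  have e := congrArg (fun m : Measure X => (m A).toReal) (invariant_eq_sum_add h hπ n)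
  simp only [Measure.add_apply, Measure.smul_apply, smul_eq_mul] at e
  rw [measureReal_def, e, ENNReal.toReal_add (ENNReal.mul_ne_top (by finiteness) (by finiteness))
    (by finiteness), ENNReal.toReal_mul, ENNReal.toReal_mul, ENNReal.toReal_ofReal h.pos.le,
    Measure.finsetSum_apply, ENNReal.toReal_sum (fun i _ => by finiteness)]
  rfl

end Taboo

/-! ### The explicit constants -/

section Constants

variable {ε lam A β : ℝ}

lemma inv_le_drift_ratio (h1 : ε < 1) (hl : 0 < lam) (hA : 1 ≤ A) :
    lam⁻¹ ≤ (A - ε) / lam / (1 - ε) := by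
  have : 0 < 1 - ε := by linarith
  rw [inv_eq_one_div, div_div, div_le_div_iff₀ hl (by positivity)]
  nlinarith

/-- For `1 < β < β*` the exponent `φ(β)` lies in `(0, 1)`, and the denominator of `g` is
positive. -/
lemma phi_bounds (h0 : 0 < ε) (h1 : ε < 1) (hl : 0 < lam) (hl1 : lam < 1) (hA : 1 ≤ A)
    (hβ : 1 < β) (hβ' : β < betaStar ε lam ((A - ε) / lam)) :
    0 < phi lam β ∧ phi lam β < 1 ∧
      (1 - ε) * ((A - ε) / lam / (1 - ε)) ^ phi lam β < 1 := by
  set J' := (A - ε) / lam with hJ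
  have hJ0 : 0 < J' := div_pos (by linarith) hl
  have he : 0 < 1 - ε := by linarith
  have hl0 : Real.log lam < 0 := Real.log_neg hl hl1
  have hle : Real.log (1 - ε) < 0 := Real.log_neg he (by linarith)
  have hb : 0 < Real.log β := Real.log_pos hβ
  have hφ : phi lam β * (-Real.log lam) = Real.log β := by
    rw [phi, Real.log_inv, div_mul_cancel₀ _ (neg_pos.2 hl0).ne']
  have hφ0 : 0 < phi lam β := by
    rw [phi, Real.log_inv]; exact div_pos hb (by linarith)
  have hlog : Real.log ((1 - ε) * (J' / (1 - ε)) ^ phi lam β)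
      = Real.log (1 - ε) + phi lam β * (Real.log J' - Real.log (1 - ε)) := by
    rw [Real.log_mul he.ne' (by positivity), Real.log_rpow (by positivity),
      Real.log_div hJ0.ne' he.ne']
  have hpos : 0 < (1 - ε) * (J' / (1 - ε)) ^ phi lam β := by positivity
  rw [← Real.log_neg_iff hpos, hlog]
  by_cases hJ1 : J' < 1
  · rw [betaStar, if_pos hJ1] at hβ'
    have h2 : Real.log β < -Real.log lam := by
      rw [← Real.log_inv]; exact Real.log_lt_log (by linarith) hβ'
    have hφ1 : phi lam β < 1 := by
      by_contra hc
      nlinarith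
    have hj : Real.log J' < 0 := Real.log_neg hJ0 hJ1
    exact ⟨hφ0, hφ1, by nlinarith⟩
  · rw [betaStar, if_neg hJ1] at hβ'
    have hj : 0 ≤ Real.log J' := Real.log_nonneg (not_lt.1 hJ1)
    have hd : 0 < Real.log J' - Real.log (1 - ε) := by linarith
    have h2 : Real.log β < Real.log lam * Real.log (1 - ε) / (Real.log J' - Real.log (1 - ε)) := by
      rw [← Real.log_exp (Real.log lam * Real.log (1 - ε) / (Real.log J' - Real.log (1 - ε)))]
      exact Real.log_lt_log (by linarith) hβ'
    rw [lt_div_iff₀ hd, ← hφ] at h2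
    have h3 : phi lam β * (Real.log J' - Real.log (1 - ε)) < -Real.log (1 - ε) := by
      by_contra hc
      nlinarith
    refine ⟨hφ0, ?_, by linarith⟩
    by_contra hc
    nlinarith

lemma lam_rpow_phi (hl : 0 < lam) (hl1 : lam < 1) (hβ : 1 < β) :
    lam ^ phi lam β = β⁻¹ := by
  have hl0 : Real.log lam < 0 := Real.log_neg hl hl1
  rw [Real.rpow_def_of_pos hl, phi, Real.log_inv,
    show Real.log lam * (Real.log β / -Real.log lam) = -Real.log β by
      have := hl0.ne
      field_simp,
    Real.exp_neg, Real.exp_log (by linarith)]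

/-- The factor of `g` multiplying `β ν(V)^φ(β)` is at least `1`, since
`β (1 - ε) ≤ (1 - ε) (J / (1 - ε))^φ(β) < 1`. -/
lemma mul_rpow_le_g (h0 : 0 < ε) (h1 : ε < 1) (hl : 0 < lam) (hl1 : lam < 1) (hA : 1 ≤ A)
    (hβ : 1 < β) (hβ' : β < betaStar ε lam ((A - ε) / lam)) {v : ℝ} (hv : 0 ≤ v) :
    β * v ^ phi lam β ≤ g v lam β ε ((A - ε) / lam) := by
  obtain ⟨hφ0, -, hc⟩ := phi_bounds h0 h1 hl hl1 hA hβ hβ'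
  have hle : β ≤ ((A - ε) / lam / (1 - ε)) ^ phi lam β := by
    calc β = (lam⁻¹) ^ phi lam β := by
          rw [Real.inv_rpow hl.le, lam_rpow_phi hl hl1 hβ, inv_inv]
      _ ≤ _ := Real.rpow_le_rpow (by positivity) (inv_le_drift_ratio h1 hl hA) hφ0.le
  refine le_mul_of_one_le_right (by positivity) ?_
  rw [one_le_div (by linarith)]
  nlinarith

end Constants

/-! ### Geometric decay of the taboo kernel -/

section Drift

variable {X : Type*} [MeasurableSpace X]

/-- Jensen's inequality for the concave function `t ↦ t ^ p`, `0 < p ≤ 1`. -/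
lemma lintegral_ofReal_rpow_le (μ : Measure X) [IsProbabilityMeasure μ] {V : X → ℝ}
    (hV : Measurable V) (hV0 : ∀ x, 0 ≤ V x) {p : ℝ} (hp : 0 < p) (hp1 : p ≤ 1) :
    ∫⁻ x, ENNReal.ofReal (V x) ^ p ∂μ ≤ (∫⁻ x, ENNReal.ofReal (V x) ∂μ) ^ p := by
  have H := eLpNorm'_le_eLpNorm'_of_exponent_le hp hp1 μ hV.aestronglyMeasurable
  simp only [eLpNorm'_eq_lintegral_enorm, Real.enorm_of_nonneg (hV0 _), ENNReal.rpow_one,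
    div_one] at H
  have := ENNReal.rpow_le_rpow H hp.le
  rwa [← ENNReal.rpow_mul, one_div, inv_mul_cancel₀ hp.ne', ENNReal.rpow_one] at this

variable {P : Kernel X X} [IsMarkovKernel P] {C : Set X}
  {ε : ℝ} {ν : Measure X} [IsProbabilityMeasure ν] {V : X → ℝ} {lam b β : ℝ}

lemma one_le_lintegral_ofReal (hd : GeometricDrift P C V lam b) (μ : Measure X)
    [IsProbabilityMeasure μ] : 1 ≤ ∫⁻ x, ENNReal.ofReal (V x) ∂μ := by
  calc (1 : ℝ≥0∞) = ∫⁻ _, 1 ∂μ := by simp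
    _ ≤ _ := lintegral_mono fun x => by simpa using hd.one_le x

lemma one_le_supPV (hd : GeometricDrift P C V lam b) (hC : C.Nonempty)
    (hA : supPV P C V < ∞) : 1 ≤ (supPV P C V).toReal := by
  obtain ⟨x, hx⟩ := hC
  rw [← ENNReal.toReal_one]
  exact ENNReal.toReal_mono hA.ne
    ((one_le_lintegral_ofReal hd (P x)).trans (le_iSup₂_of_le x hx le_rfl))

lemma lintegral_nu_lt_top (h : Minorization P C ε ν) (hC : C.Nonempty)
    (hA : supPV P C V < ∞) : ∫⁻ x, ENNReal.ofReal (V x) ∂ν < ∞ := by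
  obtain ⟨x, hx⟩ := hC
  have h1 : ENNReal.ofReal ε * ∫⁻ x, ENNReal.ofReal (V x) ∂ν ≤ PV P V x := by
    rw [← smul_eq_mul, ← lintegral_smul_measure]
    exact lintegral_mono' (h.le x hx) le_rfl
  have h2 : PV P V x < ∞ := (le_iSup₂_of_le (f := fun x _ => PV P V x) x hx le_rfl).trans_lt hA
  refine lt_top_iff_ne_top.2 fun ht => ?_
  rw [ht, ENNReal.mul_top (ENNReal.ofReal_pos.2 h.pos).ne'] at h1
  exact (h1.trans_lt h2).false

/-- On `C` the residual kernel satisfies `R V ≤ (A - ε) / (1 - ε)`, because `ν(V) ≥ 1`. -/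
lemma lintegral_residual_le (h : Minorization P C ε ν) (hd : GeometricDrift P C V lam b)
    (hA : supPV P C V < ∞) {x : X} (hx : x ∈ C) :
    ∫⁻ y, ENNReal.ofReal (V y) ∂(residual h x)
      ≤ ENNReal.ofReal (((supPV P C V).toReal - ε) / (1 - ε)) := by
  have he : 0 < 1 - ε := by linarith [h.lt_one]
  set I := ∫⁻ y, ENNReal.ofReal (V y) ∂(residual h x) with hI
  have h1 : ENNReal.ofReal ε * 1 + ENNReal.ofReal (1 - ε) * I ≤ supPV P C V := by
    calc ENNReal.ofReal ε * 1 + ENNReal.ofReal (1 - ε) * I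
        ≤ ENNReal.ofReal ε * (∫⁻ y, ENNReal.ofReal (V y) ∂ν) + ENNReal.ofReal (1 - ε) * I := by
          gcongr; exact one_le_lintegral_ofReal hd ν
      _ = PV P V x := by
          rw [PV, ← smul_add_taboo h hx, lintegral_add_measure, taboo_apply_of_mem h hx,
            lintegral_smul_measure, lintegral_smul_measure, smul_eq_mul, smul_eq_mul]
      _ ≤ supPV P C V := le_iSup₂_of_le (f := fun x _ => PV P V x) x hx le_rfl
  have hIt : I ≠ ∞ := by
    intro ht
    rw [ht, ENNReal.mul_top (ENNReal.ofReal_pos.2 he).ne', add_top] at h1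
    exact (h1.trans_lt hA).false
  rw [ENNReal.le_ofReal_iff_toReal_le hIt, le_div_iff₀ he]
  · have h2 := ENNReal.toReal_mono hA.ne h1
    rw [mul_one, ENNReal.toReal_add ENNReal.ofReal_ne_top
      (ENNReal.mul_ne_top ENNReal.ofReal_ne_top hIt), ENNReal.toReal_mul,
      ENNReal.toReal_ofReal h.pos.le, ENNReal.toReal_ofReal he.le] at h2
    linarith
  · have := one_le_supPV hd ⟨x, hx⟩ hA
    exact div_nonneg (by linarith [h.lt_one]) he.le

/-- The function `V ^ φ(β)` decays at rate `β⁻¹` under the taboo kernel. Off `C` this is the drift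
condition; on `C` it holds because the denominator of `g` is positive. -/
lemma lintegral_taboo_le (h : Minorization P C ε ν) (hd : GeometricDrift P C V lam b)
    (hA : supPV P C V < ∞) (hβ : 1 < β) (hβ' : β < betaStar ε lam (J P C V ε lam))
    (hC : C.Nonempty) (x : X) :
    ∫⁻ y, ENNReal.ofReal (V y) ^ phi lam β ∂(taboo h x)
      ≤ ENNReal.ofReal β⁻¹ * ENNReal.ofReal (V x) ^ phi lam β := by
  have hA1 := one_le_supPV hd hC hA
  obtain ⟨hφ0, hφ1, hc⟩ := phi_bounds h.pos h.lt_one hd.lam_pos hd.lam_lt_one hA1 hβ hβ'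
  have hV0 : ∀ x, 0 ≤ V x := fun x => zero_le_one.trans (hd.one_le x)
  have hlφ := lam_rpow_phi hd.lam_pos hd.lam_lt_one hβ
  have hl := hd.lam_pos
  by_cases hx : x ∈ C
  · have he : 0 < 1 - ε := by linarith [h.lt_one]
    have := isProbabilityMeasure_residual h hx
    have hJ : 0 ≤ ((supPV P C V).toReal - ε) / lam / (1 - ε) :=
      div_nonneg (div_nonneg (by linarith [h.lt_one]) hl.le) he.le
    rw [taboo_apply_of_mem h hx, lintegral_smul_measure, smul_eq_mul]
    calc ENNReal.ofReal (1 - ε) * ∫⁻ y, ENNReal.ofReal (V y) ^ phi lam β ∂(residual h x)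
        ≤ ENNReal.ofReal (1 - ε) *
            (ENNReal.ofReal (((supPV P C V).toReal - ε) / (1 - ε))) ^ phi lam β := by
          gcongr
          exact (lintegral_ofReal_rpow_le _ hd.measurable hV0 hφ0 hφ1.le).trans
            (ENNReal.rpow_le_rpow (lintegral_residual_le h hd hA hx) hφ0.le)
      _ = ENNReal.ofReal (β⁻¹ *
            ((1 - ε) * (((supPV P C V).toReal - ε) / lam / (1 - ε)) ^ phi lam β)) := by
          rw [show ((supPV P C V).toReal - ε) / (1 - ε)
              = lam * (((supPV P C V).toReal - ε) / lam / (1 - ε)) by field_simp,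
            ENNReal.ofReal_rpow_of_nonneg (by positivity) hφ0.le,
            Real.mul_rpow hl.le hJ, hlφ, ← ENNReal.ofReal_mul he.le]
          congr 1; ring
      _ ≤ ENNReal.ofReal β⁻¹ * 1 := by
          rw [mul_one]
          exact ENNReal.ofReal_le_ofReal (mul_le_of_le_one_right (by positivity) hc.le)
      _ ≤ _ := by
          gcongr
          exact ENNReal.one_le_rpow (by simpa using hd.one_le x) hφ0
  · rw [taboo_apply_of_notMem h hx]
    refine (lintegral_ofReal_rpow_le _ hd.measurable hV0 hφ0 hφ1.le).trans ?_
    have := hd.drift x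
    rw [Set.indicator_of_notMem hx, add_zero, PV] at this
    refine (ENNReal.rpow_le_rpow this hφ0.le).trans_eq ?_
    rw [ENNReal.ofReal_mul hl.le, ENNReal.mul_rpow_of_nonneg _ _ hφ0.le,
      ENNReal.ofReal_rpow_of_pos hl, hlφ]

lemma lintegral_taboo_pow_le (h : Minorization P C ε ν) (hd : GeometricDrift P C V lam b)
    (hA : supPV P C V < ∞) (hβ : 1 < β) (hβ' : β < betaStar ε lam (J P C V ε lam))
    (hC : C.Nonempty) (n : ℕ) (x : X) :
    ∫⁻ y, ENNReal.ofReal (V y) ^ phi lam β ∂((taboo h ^ n) x)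
      ≤ ENNReal.ofReal β⁻¹ ^ n * ENNReal.ofReal (V x) ^ phi lam β := by
  have hm : Measurable fun y => ENNReal.ofReal (V y) ^ phi lam β :=
    hd.measurable.ennreal_ofReal.pow_const _
  induction n with
  | zero =>
    change ∫⁻ y, _ ∂(Kernel.id x) ≤ _
    rw [Kernel.id_apply, lintegral_dirac' _ hm, pow_zero, one_mul]
  | succ n ih =>
    rw [pow_succ']
    change ∫⁻ y, _ ∂((taboo h ∘ₖ (taboo h ^ n)) x) ≤ _
    rw [Kernel.lintegral_comp _ _ _ hm]
    calc ∫⁻ y, ∫⁻ z, ENNReal.ofReal (V z) ^ phi lam β ∂(taboo h y) ∂((taboo h ^ n) x)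
        ≤ ∫⁻ y, ENNReal.ofReal β⁻¹ * ENNReal.ofReal (V y) ^ phi lam β ∂((taboo h ^ n) x) :=
          lintegral_mono fun y => lintegral_taboo_le h hd hA hβ hβ' hC y
      _ ≤ _ := by
          rw [lintegral_const_mul _ hm, pow_succ', mul_assoc]
          gcongr

/-- Geometric decay of the survival probabilities of the taboo kernel. -/
lemma taboo_pow_apply_univ_le (h : Minorization P C ε ν) (hd : GeometricDrift P C V lam b)
    (hA : supPV P C V < ∞) (hβ : 1 < β) (hβ' : β < betaStar ε lam (J P C V ε lam))
    (hC : C.Nonempty) (n : ℕ) (x : X) :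
    (taboo h ^ n) x Set.univ ≤ ENNReal.ofReal β⁻¹ ^ n * ENNReal.ofReal (V x) ^ phi lam β := by
  obtain ⟨hφ0, -, -⟩ := phi_bounds h.pos h.lt_one hd.lam_pos hd.lam_lt_one
    (one_le_supPV hd hC hA) hβ hβ'
  refine le_trans ?_ (lintegral_taboo_pow_le h hd hA hβ hβ' hC n x)
  calc (taboo h ^ n) x Set.univ = ∫⁻ _, 1 ∂((taboo h ^ n) x) := by simp
    _ ≤ _ := lintegral_mono fun y => ENNReal.one_le_rpow (by simpa using hd.one_le y) hφ0

/-- Started from `ν`, the taboo chain survives `n` steps with probability at most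
`ν(V)^φ(β) β⁻ⁿ`. -/
lemma taboo_pow_comp_nu_real_univ_le (h : Minorization P C ε ν) (hd : GeometricDrift P C V lam b)
    (hA : supPV P C V < ∞) (hβ : 1 < β) (hβ' : β < betaStar ε lam (J P C V ε lam))
    (hC : C.Nonempty) (n : ℕ) :
    ((taboo h ^ n) ∘ₘ ν).real Set.univ ≤ (∫ y, V y ∂ν) ^ phi lam β * β⁻¹ ^ n := by
  obtain ⟨hφ0, hφ1, -⟩ := phi_bounds h.pos h.lt_one hd.lam_pos hd.lam_lt_one
    (one_le_supPV hd hC hA) hβ hβ'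
  have hV0 : ∀ x, 0 ≤ V x := fun x => zero_le_one.trans (hd.one_le x)
  have hm : Measurable fun y => ENNReal.ofReal (V y) ^ phi lam β :=
    hd.measurable.ennreal_ofReal.pow_const _
  have hint : 0 ≤ ∫ y, V y ∂ν := integral_nonneg hV0
  have hβ0 : 0 ≤ β⁻¹ := by positivity
  have hνV : ∫⁻ y, ENNReal.ofReal (V y) ∂ν = ENNReal.ofReal (∫ y, V y ∂ν) := by
    rw [integral_eq_lintegral_of_nonneg_ae (.of_forall hV0) hd.measurable.aestronglyMeasurable,
      ENNReal.ofReal_toReal (lintegral_nu_lt_top h hC hA).ne]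
  refine ENNReal.toReal_le_of_le_ofReal (by positivity) ?_
  rw [Measure.bind_apply MeasurableSet.univ (Kernel.aemeasurable _)]
  calc ∫⁻ x, (taboo h ^ n) x Set.univ ∂ν
      ≤ ∫⁻ x, ENNReal.ofReal β⁻¹ ^ n * ENNReal.ofReal (V x) ^ phi lam β ∂ν :=
        lintegral_mono fun x => taboo_pow_apply_univ_le h hd hA hβ hβ' hC n x
    _ ≤ ENNReal.ofReal β⁻¹ ^ n * ENNReal.ofReal (∫ y, V y ∂ν) ^ phi lam β := by
        rw [lintegral_const_mul _ hm, ← hνV]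
        gcongr
        exact lintegral_ofReal_rpow_le _ hd.measurable hV0 hφ0 hφ1.le
    _ = _ := by
        rw [ENNReal.ofReal_rpow_of_nonneg hint hφ0.le, ← ENNReal.ofReal_pow hβ0,
          ← ENNReal.ofReal_mul (by positivity), mul_comm]

/-- The taboo chain dies out from every starting point, hence from any initial law. -/
lemma tendsto_taboo_pow_comp_univ (h : Minorization P C ε ν) (hd : GeometricDrift P C V lam b)
    (hA : supPV P C V < ∞) (hβ : 1 < β) (hβ' : β < betaStar ε lam (J P C V ε lam))
    (hC : C.Nonempty) (μ : Measure X) [IsProbabilityMeasure μ] :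
    Filter.Tendsto (fun n : ℕ => ((taboo h ^ n) ∘ₘ μ).real Set.univ) Filter.atTop (nhds 0) := by
  have key : Filter.Tendsto (fun n : ℕ => ∫⁻ x, (taboo h ^ n) x Set.univ ∂μ) Filter.atTop
      (nhds (∫⁻ _, 0 ∂μ)) := by
    refine tendsto_lintegral_of_dominated_convergence (fun _ => 1)
      (fun n => Kernel.measurable_coe _ MeasurableSet.univ)
      (fun n => .of_forall fun x => taboo_pow_apply_univ_le_one h n x) (by simp)
      (.of_forall fun x => ?_)
    refine tendsto_of_tendsto_of_tendsto_of_le_of_le tendsto_const_nhds ?_ (fun _ => zero_le)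
      (fun n => taboo_pow_apply_univ_le h hd hA hβ hβ' hC n x)
    have hlt : ENNReal.ofReal β⁻¹ < 1 := by
      rw [ENNReal.ofReal_lt_one]; exact inv_lt_one_of_one_lt₀ hβ
    obtain ⟨hφ0, -, -⟩ := phi_bounds h.pos h.lt_one hd.lam_pos hd.lam_lt_one
      (one_le_supPV hd hC hA) hβ hβ'
    have := ENNReal.Tendsto.mul_const (b := ENNReal.ofReal (V x) ^ phi lam β)
      (ENNReal.tendsto_pow_atTop_nhds_zero_of_lt_one hlt)
      (Or.inr (ENNReal.rpow_ne_top_of_nonneg hφ0.le ENNReal.ofReal_ne_top))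
    simpa using this
  rw [lintegral_zero] at key
  have := (ENNReal.tendsto_toReal ENNReal.zero_ne_top).comp key
  rw [ENNReal.toReal_zero] at this
  refine this.congr fun n => ?_
  rw [measureReal_def, Measure.bind_apply MeasurableSet.univ (Kernel.aemeasurable _)]
  rfl

/-- The part of an invariant probability measure due to paths without a visit to the atom during
the preceding `n` steps has geometrically small mass. By Kac's formula it is `ε π(C)` times a tail
of the series of survival probabilities from `ν`. -/
lemma taboo_pow_comp_invariant_real_univ_le (h : Minorization P C ε ν)
    (hd : GeometricDrift P C V lam b)
    (hA : supPV P C V < ∞) (hβ : 1 < β) (hβ' : β < betaStar ε lam (J P C V ε lam))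
    (hC : C.Nonempty) {π : Measure X} [IsProbabilityMeasure π] (hπ : Kernel.Invariant P π)
    (n : ℕ) :
    ((taboo h ^ n) ∘ₘ π).real Set.univ
      ≤ g (∫ y, V y ∂ν) lam β ε (J P C V ε lam) * β⁻¹ ^ n / (β - 1) := by
  have hV0 : ∀ x, 0 ≤ V x := fun x => zero_le_one.trans (hd.one_le x)
  set κ : ℝ := ε * π.real C with hκ
  set K : ℝ := (∫ y, V y ∂ν) ^ phi lam β with hK
  have hK0 : 0 ≤ K := Real.rpow_nonneg (integral_nonneg hV0) _
  have hκ0 : 0 ≤ κ := mul_nonneg h.pos.le measureReal_nonneg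
  have hκ1 : κ ≤ 1 := mul_le_one₀ h.lt_one.le measureReal_nonneg measureReal_le_one
  have hβ1 : β⁻¹ < 1 := inv_lt_one_of_one_lt₀ hβ
  have mass : ∀ n : ℕ, 1 = κ * ∑ i ∈ Finset.range n, ((taboo h ^ i) ∘ₘ ν).real Set.univ
      + ((taboo h ^ n) ∘ₘ π).real Set.univ := fun n => by
    rw [← invariant_real_apply h hπ, probReal_univ]
  have step : ∀ N, n ≤ N → ((taboo h ^ n) ∘ₘ π).real Set.univ
      ≤ K * (β⁻¹ ^ n / (1 - β⁻¹)) + ((taboo h ^ N) ∘ₘ π).real Set.univ := by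
    intro N hN
    have e1 := mass n
    have e2 := mass N
    rw [← Finset.sum_range_add_sum_Ico _ hN, mul_add] at e2
    have e3 : κ * ∑ i ∈ Finset.Ico n N, ((taboo h ^ i) ∘ₘ ν).real Set.univ
        ≤ K * (β⁻¹ ^ n / (1 - β⁻¹)) := by
      calc κ * ∑ i ∈ Finset.Ico n N, ((taboo h ^ i) ∘ₘ ν).real Set.univ
          ≤ 1 * ∑ i ∈ Finset.Ico n N, K * β⁻¹ ^ i := by
            gcongr with i hi
            exact taboo_pow_comp_nu_real_univ_le h hd hA hβ hβ' hC i
        _ ≤ _ := by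
            rw [one_mul, ← Finset.mul_sum]
            gcongr
            exact geom_sum_Ico_le_of_lt_one (by positivity) hβ1
    linarith
  -- let `N → ∞` in `step`
  have lim : ((taboo h ^ n) ∘ₘ π).real Set.univ ≤ K * (β⁻¹ ^ n / (1 - β⁻¹)) := by
    have := (tendsto_taboo_pow_comp_univ h hd hA hβ hβ' hC π).const_add
      (K * (β⁻¹ ^ n / (1 - β⁻¹)))
    rw [add_zero] at this
    exact ge_of_tendsto this (Filter.eventually_atTop.2 ⟨n, step⟩)
  refine lim.trans ?_
  have hg := mul_rpow_le_g h.pos h.lt_one hd.lam_pos hd.lam_lt_one (one_le_supPV hd hC hA) hβ hβ'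
    (integral_nonneg hV0 : 0 ≤ ∫ y, V y ∂ν)
  have hβ2 : 0 < β - 1 := by linarith
  calc K * (β⁻¹ ^ n / (1 - β⁻¹)) = β * K * β⁻¹ ^ n / (β - 1) := by
        field_simp
    _ ≤ _ := by
        have : 0 ≤ β⁻¹ ^ n := by positivity
        gcongr
        exact hg

end Drift

/-! ### Excursions of the split chain -/

section Paths

instance {S : Type*} [MeasurableSpace S] (κ : Kernel S S) [IsMarkovKernel κ] (μ : Measure S)
    [IsProbabilityMeasure μ] : IsProbabilityMeasure (chainLaw κ μ) := by
  unfold chainLaw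
  infer_instance

/-- The Markov property of `chainLaw` at a deterministic time, for an event determined by the path
up to that time. -/
lemma setLIntegral_chainLaw_succ {S : Type*} [MeasurableSpace S] (κ : Kernel S S)
    [IsMarkovKernel κ] (μ : Measure S) [IsProbabilityMeasure μ] (n : ℕ)
    {E : Set ((i : Finset.Iic n) → S)} (hE : MeasurableSet E) {f : S → ℝ≥0∞} (hf : Measurable f) :
    ∫⁻ ω in Preorder.frestrictLe (π := fun _ : ℕ => S) n ⁻¹' E, f (ω (n + 1)) ∂(chainLaw κ μ)
      = ∫⁻ ω in Preorder.frestrictLe (π := fun _ : ℕ => S) n ⁻¹' E,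
          ∫⁻ y, f y ∂(κ (ω n)) ∂(chainLaw κ μ) := by
  let κ' : (n : ℕ) → Kernel ((i : Finset.Iic n) → S) S := fun n =>
    κ.comap (fun h : (i : Finset.Iic n) → S => h ⟨n, Finset.mem_Iic.2 le_rfl⟩)
      (measurable_pi_apply _)
  have key := Kernel.map_frestrictLe_trajMeasure_compProd_eq_map_trajMeasure
    (X := fun _ : ℕ => S) (μ₀ := μ) (κ := κ') (a := n)
  change (chainLaw κ μ).map _ ⊗ₘ κ' n = (chainLaw κ μ).map _ at key
  have hr : Measurable (Preorder.frestrictLe (π := fun _ : ℕ => S) n) := by fun_prop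
  have hF : Measurable fun p : ((i : Finset.Iic n) → S) × S =>
      E.indicator (fun _ => (1 : ℝ≥0∞)) p.1 * f p.2 :=
    ((measurable_const.indicator hE).comp measurable_fst).mul (hf.comp measurable_snd)
  have e := congrArg (fun m => ∫⁻ p, E.indicator (fun _ => (1 : ℝ≥0∞)) p.1 * f p.2 ∂m) key
  rw [Measure.lintegral_compProd hF, lintegral_map (by fun_prop) hr,
    lintegral_map hF (by fun_prop)] at e
  rw [← lintegral_indicator (hr hE), ← lintegral_indicator (hr hE)]
  refine Eq.trans ?_ (e.symm.trans ?_)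
  · refine lintegral_congr fun ω => ?_
    by_cases hω : Preorder.frestrictLe (π := fun _ : ℕ => S) n ω ∈ E
    · rw [Set.indicator_of_mem (by exact hω), Set.indicator_of_mem hω, one_mul]
    · rw [Set.indicator_of_notMem (by exact hω), Set.indicator_of_notMem hω, zero_mul]
  · refine lintegral_congr fun ω => ?_
    change ∫⁻ y, E.indicator (fun _ => (1 : ℝ≥0∞)) (Preorder.frestrictLe n ω) * f y ∂(κ (ω n)) = _
    rw [lintegral_const_mul _ hf]
    by_cases hω : Preorder.frestrictLe (π := fun _ : ℕ => S) n ω ∈ E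
    · rw [Set.indicator_of_mem hω, Set.indicator_of_mem (by exact hω), one_mul]
    · rw [Set.indicator_of_notMem hω, Set.indicator_of_notMem (by exact hω), zero_mul]

variable {X : Type*} [MeasurableSpace X] {P : Kernel X X} [IsMarkovKernel P] {C : Set X}
  {ε : ℝ} {ν : Measure X} [IsProbabilityMeasure ν]

lemma lintegral_ber (ε : ℝ) (f : Bool → ℝ≥0∞) :
    ∫⁻ δ, f δ ∂(ber ε) = ENNReal.ofReal ε * f true + ENNReal.ofReal (1 - ε) * f false := by
  rw [ber, lintegral_add_measure, lintegral_smul_measure, lintegral_smul_measure,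
    lintegral_dirac, lintegral_dirac]
  rfl

lemma splitKernel_apply (h : Minorization P C ε ν) (z : X × Bool) :
    splitKernel h z = (splitStep h z).prod (ber ε) := by
  have := isProbabilityMeasure_ber h
  rw [splitKernel, Kernel.prod_apply, Kernel.const_apply]

lemma splitStep_of_notMem (h : Minorization P C ε ν) {x : X} (hx : x ∉ C) (δ : Bool) :
    splitStep h (x, δ) = P x := by
  classical
  rw [splitStep, Kernel.piecewise_apply, if_neg (by exact hx), Kernel.comap_apply]

lemma splitStep_true (h : Minorization P C ε ν) {x : X} (hx : x ∈ C) :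
    splitStep h (x, true) = ν := by
  classical
  rw [splitStep, Kernel.piecewise_apply, if_pos (by exact hx), Kernel.piecewise_apply,
    if_pos (by simp), Kernel.const_apply]

lemma splitStep_false (h : Minorization P C ε ν) {x : X} (hx : x ∈ C) :
    splitStep h (x, false) = residual h x := by
  classical
  rw [splitStep, Kernel.piecewise_apply, if_pos (by exact hx), Kernel.piecewise_apply,
    if_neg (by simp), Kernel.comap_apply]

lemma measurableSet_atom (h : Minorization P C ε ν) : MeasurableSet (atom C) :=
  h.measurableSet.prod (measurableSet_singleton true)

/-- One step of the split chain killed in the atom, with the current second coordinate averaged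
out, is one step of the taboo kernel. -/
lemma lintegral_ber_indicator_splitKernel (h : Minorization P C ε ν) {f : X × Bool → ℝ≥0∞}
    (hf : Measurable f) (x : X) :
    ∫⁻ δ, (atom C)ᶜ.indicator (fun z => ∫⁻ y, f y ∂(splitKernel h z)) (x, δ) ∂(ber ε)
      = ∫⁻ y, ∫⁻ δ, f (y, δ) ∂(ber ε) ∂(taboo h x) := by
  have := isProbabilityMeasure_ber h
  have h0 : 0 ≤ 1 - ε := by linarith [h.lt_one]
  rw [lintegral_ber]
  by_cases hx : x ∈ C
  · rw [Set.indicator_of_notMem (by simp [atom, hx]), Set.indicator_of_mem (by simp [atom]),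
      mul_zero, zero_add, splitKernel_apply, splitStep_false h hx, taboo_apply_of_mem h hx,
      lintegral_smul_measure, smul_eq_mul, lintegral_prod _ hf.aemeasurable]
  · rw [Set.indicator_of_mem (by simp [atom, hx]), Set.indicator_of_mem (by simp [atom]),
      splitKernel_apply, splitKernel_apply, splitStep_of_notMem h hx, splitStep_of_notMem h hx,
      taboo_apply_of_notMem h hx, ← add_mul, ← ENNReal.ofReal_add h.pos.le h0,
      add_sub_cancel, ENNReal.ofReal_one, one_mul, lintegral_prod _ hf.aemeasurable]

/-- Paths that start in the atom and do not return to it at the times `1, …, n`. -/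
def excursion (C : Set X) (n : ℕ) : Set (ℕ → X × Bool) :=
  {ω | ω 0 ∈ atom C ∧ ∀ i, 1 ≤ i → i ≤ n → ω i ∉ atom C}

lemma excursion_eq_preimage (h : Minorization P C ε ν) (n : ℕ) :
    ∃ E : Set ((i : Finset.Iic n) → X × Bool), MeasurableSet E ∧
      excursion C n = Preorder.frestrictLe (π := fun _ : ℕ => X × Bool) n ⁻¹' E := by
  have hα := measurableSet_atom h
  have hm : ∀ j : Finset.Iic n, Measurable fun w : (i : Finset.Iic n) → X × Bool => w j :=
    fun j => measurable_pi_apply j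
  refine ⟨(fun w => w ⟨0, by simp⟩) ⁻¹' atom C ∩
    ⋂ (i : Finset.Iic n) (_ : 1 ≤ (i : ℕ)), (fun w => w i) ⁻¹' (atom C)ᶜ, ?_, ?_⟩
  · exact (hm _ hα).inter (MeasurableSet.iInter fun i =>
      MeasurableSet.iInter fun _ => hm i hα.compl)
  · ext ω
    simp only [excursion, Set.mem_ofPred_eq, Set.mem_preimage, Preorder.frestrictLe_apply,
      Set.mem_inter_iff, Set.mem_iInter, Set.mem_compl_iff, Subtype.forall, Finset.mem_Iic]
    exact and_congr_right fun _ => ⟨fun H i hi h1 => H i h1 hi, fun H i h1 hi => H i hi h1⟩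

lemma measurableSet_excursion (h : Minorization P C ε ν) (n : ℕ) :
    MeasurableSet (excursion C n : Set (ℕ → X × Bool)) := by
  obtain ⟨E, hE, he⟩ := excursion_eq_preimage h n
  rw [he]
  exact (by fun_prop : Measurable (Preorder.frestrictLe (π := fun _ : ℕ => X × Bool) n)) hE

lemma chainLaw_map_zero {S : Type*} [MeasurableSpace S] (κ : Kernel S S) [IsMarkovKernel κ]
    (μ : Measure S) [IsProbabilityMeasure μ] :
    (chainLaw κ μ).map (fun ω => ω 0) = μ := by
  have hm : Measurable fun w : (i : Finset.Iic 0) → S => w ⟨0, by simp⟩ := measurable_pi_apply _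
  have hr : Measurable (Preorder.frestrictLe (π := fun _ : ℕ => S) 0) := by fun_prop
  have : (fun ω : ℕ → S => ω 0) = (fun w : (i : Finset.Iic 0) → S => w ⟨0, by simp⟩)
      ∘ Preorder.frestrictLe (π := fun _ : ℕ => S) 0 := rfl
  rw [this, ← Measure.map_map hm hr, chainLaw, Kernel.trajMeasure, Measure.map_comp _ _ hr,
    Kernel.traj_map_frestrictLe, Kernel.partialTraj_self, Measure.id_comp,
    Measure.map_map hm (by fun_prop)]
  exact Measure.map_id

/-- The state reached one step after `n` steps of an excursion has first coordinate distributed as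
the `n`-th taboo iterate of `ν`, and an independent Bernoulli second coordinate. -/
lemma setLIntegral_excursion (h : Minorization P C ε ν) (μ : Measure (X × Bool))
    [IsProbabilityMeasure μ] (n : ℕ) {f : X × Bool → ℝ≥0∞} (hf : Measurable f) :
    ∫⁻ ω in excursion C n, f (ω (n + 1)) ∂(chainLaw (splitKernel h) μ)
      = μ (atom C) * ∫⁻ x, ∫⁻ δ, f (x, δ) ∂(ber ε) ∂((taboo h ^ n) ∘ₘ ν) := by
  have := isProbabilityMeasure_ber h
  have hα := measurableSet_atom h
  induction n generalizing f with
  | zero =>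
    obtain ⟨E, hE, he⟩ := excursion_eq_preimage h 0
    have hset : (excursion C 0 : Set (ℕ → X × Bool)) = (fun ω => ω 0) ⁻¹' atom C := by
      ext ω
      exact and_iff_left fun i h1 h2 => absurd (h1.trans h2) (by norm_num)
    rw [he, setLIntegral_chainLaw_succ _ _ _ hE hf, ← he]
    have hc : ∀ ω ∈ (excursion C 0 : Set (ℕ → X × Bool)),
        ∫⁻ y, f y ∂(splitKernel h (ω 0)) = ∫⁻ x, ∫⁻ δ, f (x, δ) ∂(ber ε) ∂ν := by
      rintro ω ⟨⟨h1, h2⟩, -⟩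
      have hω : ω 0 = ((ω 0).1, true) := Prod.ext rfl h2
      rw [splitKernel_apply, lintegral_prod _ hf.aemeasurable, hω, splitStep_true h h1]
    rw [setLIntegral_congr_fun (measurableSet_excursion h 0) hc, setLIntegral_const, hset,
      ← Measure.map_apply (measurable_pi_apply 0) hα, chainLaw_map_zero, pow_zero,
      show (1 : Kernel X X) = Kernel.id from rfl, Measure.id_comp, mul_comm]
  | succ n ih =>
    obtain ⟨E, hE, he⟩ := excursion_eq_preimage h (n + 1)
    have hκf : Measurable fun z => ∫⁻ y, f y ∂(splitKernel h z) := hf.lintegral_kernel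
    have hset : (excursion C (n + 1) : Set (ℕ → X × Bool))
        = excursion C n ∩ (fun ω => ω (n + 1)) ⁻¹' (atom C)ᶜ := by
      ext ω
      constructor
      · rintro ⟨h0, h1⟩
        exact ⟨⟨h0, fun i hi hn => h1 i hi (by omega)⟩, h1 (n + 1) (by omega) le_rfl⟩
      · rintro ⟨⟨h0, h1⟩, h2⟩
        refine ⟨h0, fun i hi hn => ?_⟩
        rcases Nat.le_succ_iff.1 hn with h3 | rfl
        · exact h1 i hi h3
        · exact h2
    rw [he, setLIntegral_chainLaw_succ _ _ _ hE hf, ← he, hset, Set.inter_comm,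
      ← Measure.restrict_restrict (measurable_pi_apply (n + 1) hα.compl),
      ← lintegral_indicator (measurable_pi_apply (n + 1) hα.compl)]
    refine Eq.trans ?_ ((ih (hκf.indicator hα.compl)).trans ?_)
    · rfl
    · simp_rw [lintegral_ber_indicator_splitKernel h hf]
      rw [taboo_pow_succ_comp]
      exact congrArg _ (Measure.lintegral_bind (Kernel.aemeasurable _)
        (hf.lintegral_prod_right' (ν := ber ε)).aemeasurable).symm

lemma le_returnTime_iff (C : Set X) (n : ℕ) (ω : ℕ → X × Bool) :
    ((n + 1 : ℕ) : ℕ∞) ≤ returnTime C ω ↔ ∀ i, 1 ≤ i → i ≤ n → ω i ∉ atom C := by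
  simp only [returnTime, le_iInf_iff, Nat.cast_le]
  constructor
  · intro H i h1 hn hi
    have := H i ⟨h1, hi⟩
    omega
  · rintro H i ⟨h1, hi⟩
    by_contra hc
    exact H i h1 (by omega) hi

lemma measurableSet_le_returnTime (h : Minorization P C ε ν) (n : ℕ) :
    MeasurableSet {ω : ℕ → X × Bool | ((n + 1 : ℕ) : ℕ∞) ≤ returnTime C ω} := by
  simp_rw [le_returnTime_iff, Set.ofPred_forall]
  exact MeasurableSet.iInter fun i => MeasurableSet.iInter fun _ => MeasurableSet.iInter fun _ =>
    (measurable_pi_apply i (measurableSet_atom h)).compl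

/-- `Pr_α(X_{n+1} ∈ A, τ_α ≥ n + 1)` is the `n`-th taboo iterate of `ν`, evaluated at `A`. -/
lemma prAtom_returnTime_inter (h : Minorization P C ε ν) (μ : Measure (X × Bool))
    [IsProbabilityMeasure μ] (hμ : 0 < μ (atom C)) (n : ℕ) {A : Set X} (hA : MeasurableSet A) :
    prAtom h μ ({ω | ((n + 1 : ℕ) : ℕ∞) ≤ returnTime C ω} ∩ (fun ω => (ω (n + 1)).1) ⁻¹' A)
      = ((taboo h ^ n) ∘ₘ ν) A := by
  have := isProbabilityMeasure_ber h
  have hα := measurableSet_atom h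
  have hmA : MeasurableSet ((fun ω : ℕ → X × Bool => (ω (n + 1)).1) ⁻¹' A) :=
    (measurable_fst.comp (measurable_pi_apply (n + 1))) hA
  have h0 : MeasurableSet {ω : ℕ → X × Bool | ω 0 ∈ atom C} := measurable_pi_apply 0 hα
  have hset : {ω : ℕ → X × Bool | ω 0 ∈ atom C} ∩
      ({ω | ((n + 1 : ℕ) : ℕ∞) ≤ returnTime C ω} ∩ (fun ω => (ω (n + 1)).1) ⁻¹' A)
      = (fun ω => (ω (n + 1)).1) ⁻¹' A ∩ excursion C n := by
    ext ω
    simp only [Set.mem_inter_iff, Set.mem_ofPred_eq, le_returnTime_iff, excursion]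
    tauto
  have hinit : chainLaw (splitKernel h) μ {ω | ω 0 ∈ atom C} = μ (atom C) := by
    conv_rhs => rw [← chainLaw_map_zero (splitKernel h) μ]
    rw [Measure.map_apply (measurable_pi_apply 0) hα]
    rfl
  have hf : Measurable fun z : X × Bool => A.indicator (fun _ => (1 : ℝ≥0∞)) z.1 :=
    (measurable_const.indicator hA).comp measurable_fst
  have key := setLIntegral_excursion h μ n hf
  simp only [lintegral_const, measure_univ, mul_one] at key
  rw [lintegral_indicator hA, lintegral_const, one_mul, Measure.restrict_apply_univ] at key
  have hl : ∫⁻ ω in excursion C n, A.indicator (fun _ => (1 : ℝ≥0∞)) (ω (n + 1)).1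
      ∂(chainLaw (splitKernel h) μ)
      = chainLaw (splitKernel h) μ ((fun ω => (ω (n + 1)).1) ⁻¹' A ∩ excursion C n) := by
    rw [← Measure.restrict_apply hmA, ← lintegral_indicator_one hmA]
    rfl
  rw [prAtom, cond_apply h0, hset, ← hl, key, hinit, ← mul_assoc,
    ENNReal.inv_mul_cancel hμ.ne' (measure_ne_top _ _), one_mul]

lemma prAtom_returnTime (h : Minorization P C ε ν) (μ : Measure (X × Bool))
    [IsProbabilityMeasure μ] (hμ : 0 < μ (atom C)) (n : ℕ) :
    prAtom h μ {ω | ((n + 1 : ℕ) : ℕ∞) ≤ returnTime C ω}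
      = ((taboo h ^ n) ∘ₘ ν) Set.univ := by
  simpa using prAtom_returnTime_inter h μ hμ n MeasurableSet.univ

/-- `p̃_{n+1} Q_{n+1}` is the `n`-th taboo iterate of `ν` divided by the sum of the tail
probabilities. If the tail probability vanishes, both sides are `0`. -/
lemma ofReal_pTilde_mul_Q (h : Minorization P C ε ν) (μ : Measure (X × Bool))
    [IsProbabilityMeasure μ] (hμ : 0 < μ (atom C)) (M n : ℕ) {A : Set X} (hA : MeasurableSet A) :
    (ENNReal.ofReal (pTilde h μ M (n + 1)) * Q h μ (n + 1) A).toReal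
      = ((taboo h ^ n) ∘ₘ ν).real A / ∑ s ∈ Finset.Icc 1 M, tailProb h μ s := by
  have hm : Measurable fun ω : ℕ → X × Bool => (ω (n + 1)).1 :=
    measurable_fst.comp (measurable_pi_apply (n + 1))
  have ht : tailProb h μ (n + 1) = ((taboo h ^ n) ∘ₘ ν).real Set.univ := by
    rw [tailProb, measureReal_def, prAtom_returnTime h μ hμ, measureReal_def]
  have hp : 0 ≤ pTilde h μ M (n + 1) :=
    div_nonneg measureReal_nonneg (Finset.sum_nonneg fun _ _ => measureReal_nonneg)
  rw [ENNReal.toReal_mul, ENNReal.toReal_ofReal hp, Q, Measure.map_apply hm hA,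
    cond_apply (measurableSet_le_returnTime h n), prAtom_returnTime_inter h μ hμ n hA,
    prAtom_returnTime h μ hμ, ENNReal.toReal_mul, ENNReal.toReal_inv, pTilde, ht,
    ← measureReal_def, ← measureReal_def]
  by_cases hz : ((taboo h ^ n) ∘ₘ ν).real Set.univ = 0
  · have : ((taboo h ^ n) ∘ₘ ν).real A = 0 :=
      le_antisymm (hz ▸ measureReal_mono (Set.subset_univ A)) measureReal_nonneg
    simp [hz, this]
  · field_simp

/-- The approximation `π̃` is the normalization of the first `M` terms of Kac's formula. -/
lemma piTilde_real_apply (h : Minorization P C ε ν) (μ : Measure (X × Bool))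
    [IsProbabilityMeasure μ] (hμ : 0 < μ (atom C)) (M : ℕ) {A : Set X} (hA : MeasurableSet A) :
    (piTilde h μ M).real A = (∑ i ∈ Finset.range M, ((taboo h ^ i) ∘ₘ ν).real A)
      / ∑ i ∈ Finset.range M, ((taboo h ^ i) ∘ₘ ν).real Set.univ := by
  have hI : ∀ F : ℕ → ℝ, ∑ t ∈ Finset.Icc 1 M, F t = ∑ i ∈ Finset.range M, F (i + 1) := by
    intro F
    rw [Finset.range_eq_Ico, Finset.sum_Ico_add' F 0 M 1]
    rfl
  have hS : ∑ s ∈ Finset.Icc 1 M, tailProb h μ s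
      = ∑ i ∈ Finset.range M, ((taboo h ^ i) ∘ₘ ν).real Set.univ := by
    rw [hI]
    refine Finset.sum_congr rfl fun i _ => ?_
    rw [tailProb, measureReal_def, prAtom_returnTime h μ hμ, measureReal_def]
  have hfin : ∀ t, Q h μ t A ≠ ∞ := fun t => by unfold Q; finiteness
  rw [measureReal_def, piTilde, Measure.finsetSum_apply,
    ENNReal.toReal_sum (fun t _ => by
      rw [Measure.smul_apply, smul_eq_mul]
      exact ENNReal.mul_ne_top ENNReal.ofReal_ne_top (hfin t))]
  simp only [Measure.smul_apply, smul_eq_mul]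
  rw [hI, ← hS, Finset.sum_div]
  exact Finset.sum_congr rfl fun i _ => ofReal_pTilde_mul_Q h μ hμ M i hA

end Paths

/-! ### Total variation distance to a normalized truncation -/

/-- Two finite measures that differ by at most `c / 2` on every measurable set are at total
variation distance at most `c`. -/
lemma totalVariation_sub_le {X : Type*} [MeasurableSpace X] (μ ν : Measure X) [IsFiniteMeasure μ]
    [IsFiniteMeasure ν] {c : ℝ} (H : ∀ A, MeasurableSet A → |μ.real A - ν.real A| ≤ c / 2) :
    (μ.toSignedMeasure - ν.toSignedMeasure).totalVariation Set.univ ≤ ENNReal.ofReal c := by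
  obtain ⟨i, hi, hi₂, hi₃, hp, hn⟩ :=
    (μ.toSignedMeasure - ν.toSignedMeasure).toJordanDecomposition_spec
  have e1 : (μ.toSignedMeasure - ν.toSignedMeasure).toJordanDecomposition.posPart.real Set.univ
      ≤ c / 2 := by
    rw [hp, SignedMeasure.toMeasureOfZeroLE_real_apply _ hi₂ hi MeasurableSet.univ, Set.inter_univ,
      Measure.toSignedMeasure_sub_apply hi]
    exact (le_abs_self _).trans (H i hi)
  have e2 : (μ.toSignedMeasure - ν.toSignedMeasure).toJordanDecomposition.negPart.real Set.univ
      ≤ c / 2 := by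
    rw [hn, SignedMeasure.toMeasureOfLEZero_real_apply _ hi₃ hi.compl MeasurableSet.univ,
      Set.inter_univ, Measure.toSignedMeasure_sub_apply hi.compl]
    exact (neg_le_abs _).trans (H _ hi.compl)
  rw [SignedMeasure.totalVariation, ← ofReal_measureReal (by finiteness),
    measureReal_add_apply (by finiteness) (by finiteness)]
  exact ENNReal.ofReal_le_ofReal (by linarith)

/-- If a probability measure is `κ ρ + s` with `ρ`, `s` of total masses `S`, `R`, then it differs
from the normalization `ρ / S` by at most `R` on every set. Here `ρ` and `s` stand for the values
on the set considered. -/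
lemma abs_add_sub_div_le {κ ρ S s R : ℝ} (hmass : 1 = κ * S + R) (hS : 0 < S) (hρ : 0 ≤ ρ)
    (hρS : ρ ≤ S) (hs : 0 ≤ s) (hsR : s ≤ R) : |κ * ρ + s - ρ / S| ≤ R := by
  have hR : 0 ≤ R := hs.trans hsR
  have e : κ * ρ + s - ρ / S = s - ρ / S * R := by
    rw [show R = 1 - κ * S by linarith]
    field_simp
    ring
  have h1 : ρ / S * R ≤ R := mul_le_of_le_one_left hR ((div_le_one hS).2 hρS)
  have h2 : 0 ≤ ρ / S * R := by positivity
  rw [e, abs_le]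
  constructor <;> linarith

end SplitChain

/-! ### The truncated approximation -/

theorem theorem3 {X : Type*} [MeasurableSpace X]
    (P : ProbabilityTheory.Kernel X X) [ProbabilityTheory.IsMarkovKernel P]
    (π : MeasureTheory.Measure X) [MeasureTheory.IsProbabilityMeasure π]
    (hπ : SplitChain.IsPositiveHarris P π)
    (C : Set X) (hπC : 0 < π C) (ε : ℝ)
    (ν : MeasureTheory.Measure X) [MeasureTheory.IsProbabilityMeasure ν]
    (hmin : SplitChain.Minorization P C ε ν)
    (V : X → ℝ) (lam b : ℝ) (hdrift : SplitChain.GeometricDrift P C V lam b)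
    (hA : SplitChain.supPV P C V < ∞)
    -- the initial law of the split chain, arbitrary up to charging the atom `C × {1}`
    (μ : MeasureTheory.Measure (X × Bool)) [MeasureTheory.IsProbabilityMeasure μ]
    (hμ : 0 < μ (SplitChain.atom C))
    (γ : ℝ) (hγ : 0 < γ)
    (β : ℝ) (hβ : 1 < β)
    (hβ' : β < SplitChain.betaStar ε lam (SplitChain.J P C V ε lam))
    (M : ℕ) (hM1 : 1 ≤ M)
    (hM : Real.log (2 * SplitChain.g (∫ y, V y ∂ν) lam β ε (SplitChain.J P C V ε lam)
        / (γ * (β - 1))) / Real.log β < (M : ℝ)) :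
    (π.toSignedMeasure - (SplitChain.piTilde hmin μ M).toSignedMeasure).totalVariation Set.univ
      ≤ ENNReal.ofReal γ := by
  have hC : C.Nonempty := nonempty_of_measure_ne_zero hπC.ne'
  refine SplitChain.totalVariation_sub_le _ _ fun A hAm => ?_
  have hβ0 : 0 < Real.log β := Real.log_pos hβ
  have hβ1 : 0 < β - 1 := by linarith
  have hV1 : 1 ≤ ∫⁻ x, ENNReal.ofReal (V x) ∂ν := SplitChain.one_le_lintegral_ofReal hdrift ν
  have hνV : 0 < ∫ y, V y ∂ν := by
    rw [integral_eq_lintegral_of_nonneg_ae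
      (.of_forall fun x => zero_le_one.trans (hdrift.one_le x))
      hdrift.measurable.aestronglyMeasurable]
    exact ENNReal.toReal_pos (zero_lt_one.trans_le hV1).ne'
      (SplitChain.lintegral_nu_lt_top hmin hC hA).ne
  set G := SplitChain.g (∫ y, V y ∂ν) lam β ε (SplitChain.J P C V ε lam) with hG
  have hG0 : 0 < G :=
    (by positivity : 0 < β * (∫ y, V y ∂ν) ^ SplitChain.phi lam β).trans_le
      (SplitChain.mul_rpow_le_g hmin.pos hmin.lt_one hdrift.lam_pos hdrift.lam_lt_one
        (SplitChain.one_le_supPV hdrift hC hA) hβ hβ' hνV.le)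
  have hrM : ((SplitChain.taboo hmin ^ M) ∘ₘ π).real Set.univ ≤ γ / 2 := by
    refine (SplitChain.taboo_pow_comp_invariant_real_univ_le hmin hdrift hA hβ hβ' hC
      hπ.invariant M).trans ?_
    -- exponentiate the lower bound on `M`
    rw [div_lt_iff₀ hβ0, ← Real.log_pow, Real.log_lt_log_iff (by positivity) (by positivity),
      div_lt_iff₀ (by positivity)] at hM
    rw [← hG, inv_pow, div_le_iff₀ hβ1, mul_inv_le_iff₀ (by positivity)]
    linarith
  have hSpos : 0 < ∑ i ∈ Finset.range M, ((SplitChain.taboo hmin ^ i) ∘ₘ ν).real Set.univ := by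
    refine Finset.sum_pos' (fun i _ => measureReal_nonneg) ⟨0, Finset.mem_range.2 hM1, ?_⟩
    rw [pow_zero, show (1 : Kernel X X) = Kernel.id from rfl, Measure.id_comp, probReal_univ]
    exact one_pos
  have hmass := SplitChain.invariant_real_apply hmin hπ.invariant M Set.univ
  rw [probReal_univ] at hmass
  rw [SplitChain.piTilde_real_apply hmin μ hμ M hAm,
    SplitChain.invariant_real_apply hmin hπ.invariant M A]
  exact (SplitChain.abs_add_sub_div_le hmass hSpos
    (Finset.sum_nonneg fun i _ => measureReal_nonneg)
    (Finset.sum_le_sum fun i _ => measureReal_mono (Set.subset_univ A))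
    measureReal_nonneg (measureReal_mono (Set.subset_univ A))).trans hrM
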